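/- An \emph{über-virtual pseudodiagram} is a virtual knot diagram (a generic closed oriented curve on the sphere or in the plane) each of whose crossings is virtual, positive classical, negative classical, or an undetermined \emph{precrossing}. A \emph{resolution} of it is a virtual knot diagram obtained by making each precrossing virtual, positive classical or negative classical, all other crossings being kept. Its \emph{chord diagram} is the circle parametrizing the curve with one chord for each classical crossing and each precrossing, joining the two preimages of that crossing. A virtual knot, i.e. an equivalence class of virtual knot diagrams under classical and virtual Reidemeister moves, is \emph{non-classical} if every diagram representing it has at least one virtual crossing. \textbf{Corollary.} Let $P$ be an über-virtual pseudodiagram (with any number of crossings of each type). If $P$ has two precrossings $a$ and $b$ whose chords intersect in the chord diagram of $P$, then $P$ has a resolution that represents a non-classical virtual knot. -/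

import Mathlib

/-!  Oriented virtual knot diagrams on the sphere, recorded combinatorially.

A diagram is an oriented closed curve with transverse double points in the sphere. Travelling once
around the curve one reads a cyclic word of *passes*, two for every crossing (virtual crossings and
precrossings included). If `v`, `w` are the tangent vectors at a crossing, ordered so that `(v, w)`
is a positive basis, then the pass in direction `v` has side `true` and the pass in direction `w`
has side `false`. The word with its sides determines the cellularly embedded 4-valent graph, and it
comes from a curve in the sphere exactly when the Euler characteristic is 2. -/

namespace VirtualKnots

/-- A pass through a crossing: the name of the crossing and the side of the pass. -/
abbrev Pass := ℕ × Bool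

/-- The other pass through the same crossing. -/
def Pass.flip (p : Pass) : Pass := (p.1, !p.2)

/-- A pass together with an orientation: `(p, true)` is the half-edge leaving `p` forwards along the
curve, `(p, false)` is the half-edge leaving `p` backwards. -/
abbrev HalfEdge := Pass × Bool

/-- One step along the boundary of the face on the left: follow the half-edge to the next pass `q`
(in the chosen direction along the cyclic word) and turn left there. If the curve is traversed
forwards and `q` has side `true`, the other strand points to the left, so one leaves forwards along
it; each change of direction or of side reverses this. -/
def faceStep (s : List Pass) (d : HalfEdge) : HalfEdge :=
  let q : Pass := if d.2 then s.formPerm d.1 else s.formPerm.symm d.1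
  (q.flip, d.2 == q.2)

/-- The half-edges of the embedded graph of a cyclic word. -/
abbrev HalfEdgeOf (s : List Pass) := {d : HalfEdge // d.1 ∈ s}

/-- The number of faces: orbits of `faceStep` on the half-edges. -/
noncomputable def faceCount (s : List Pass) : ℕ :=
  Nat.card (Quot fun d e : HalfEdgeOf s => (e : HalfEdge) = faceStep s d)

/-- Planarity (genus 0). With `n` crossings, `s.length = 2 * n`, and there are `n` vertices and
`2 * n` edges, so that Euler characteristic 2 means `n + 2` faces. The empty word is the embedded
circle, which has no vertices. -/
def IsPlanar (s : List Pass) : Prop :=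
  s = [] ∨ 2 * faceCount s = s.length + 4

/-- A pass through a crossing, with the crossing type (an element of `T`). -/
structure Visit (T : Type) where
  crossing : ℕ
  side : Bool
  kind : T

namespace Visit

variable {T : Type}

/-- The other visit of the same crossing. -/
def flip (x : Visit T) : Visit T := ⟨x.crossing, !x.side, x.kind⟩

/-- The underlying pass. -/
def pass (x : Visit T) : Pass := (x.crossing, x.side)

/-- Rename the crossing. -/
def rename (σ : Equiv.Perm ℕ) (x : Visit T) : Visit T := ⟨σ x.crossing, x.side, x.kind⟩

end Visit

/-- A diagram of one oriented closed curve on the sphere with crossing types in `T`: each crossing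
is visited exactly twice, once on each side, with the same type, and the curve is planar. -/
structure Diagram (T : Type) where
  word : List (Visit T)
  nodup : (word.map Visit.pass).Nodup
  flip_mem : ∀ x ∈ word, x.flip ∈ word
  planar : IsPlanar (word.map Visit.pass)

/-- The types of determined crossings: virtual, or classical of local writhe `+1` or `-1`. -/
inductive Kind where
  | virt
  | pos
  | neg
deriving DecidableEq

/-- Change the local writhe of a classical crossing; virtual crossings are unchanged. -/
def Kind.opp : Kind → Kind
  | .virt => .virt
  | .pos => .neg
  | .neg => .pos

/-- The types of crossings of a pseudodiagram: determined ones, and precrossings. -/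
inductive PseudoKind where
  | determined (k : Kind)
  | pre
deriving DecidableEq

/-- A virtual knot diagram. -/
abbrev VirtualDiagram := Diagram Kind

/-- An über-virtual pseudodiagram: each crossing is virtual, positive, negative or a precrossing. -/
abbrev UberVirtualPseudodiagram := Diagram PseudoKind

/-- The visit is the over-strand of a classical crossing. At a positive crossing
(over direction, under direction) is a positive basis, at a negative one a negative basis. -/
def Visit.IsOver (x : Visit Kind) : Prop :=
  (x.kind = .pos ∧ x.side = true) ∨ (x.kind = .neg ∧ x.side = false)

/-- The two-letter word `x y` if `e` is `true` and `y x` if `e` is `false`. -/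
def ordered (e : Bool) (x y : Visit Kind) : List (Visit Kind) :=
  if e then [x, y] else [y, x]

/-- Data of a triangle on which a third Reidemeister move is possible. Strand 1 contains `a`, `b`,
strand 2 contains `a.flip`, `c`, and strand 3 contains `b.flip`, `c.flip`; `e₁, e₂, e₃` tell in
which order. The two equations say that the three arcs bound a triangular face. Either strand 1 is
over strands 2 and 3, and strand 2 is over strand 3 (classical move), or strand 1 has only virtual
crossings and `c` is a crossing of any type (the two virtual moves). -/
structure IsTriangle (a b c : Visit Kind) (e₁ e₂ e₃ : Bool) : Prop where
  face_ab : (a.side == (e₁ == e₂)) = (b.side == (e₁ == e₃))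
  face_ac : (a.side == (e₁ == e₂)) = (c.side == (e₂ == e₃))
  kinds : (a.IsOver ∧ b.IsOver ∧ c.IsOver) ∨ (a.kind = .virt ∧ b.kind = .virt)

/-- Classical and virtual Reidemeister moves on cyclic words. -/
inductive Move : List (Visit Kind) → List (Visit Kind) → Prop
  /-- The words are cyclic. -/
  | rotate (u v : List (Visit Kind)) : Move (u ++ v) (v ++ u)
  /-- The names of the crossings are irrelevant. -/
  | rename (σ : Equiv.Perm ℕ) (u : List (Visit Kind)) : Move u (u.map (Visit.rename σ))
  /-- First move, classical or virtual: a kink. -/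
  | one (x : Visit Kind) (u : List (Visit Kind)) : Move u ([x, x.flip] ++ u)
  /-- Second move, classical or virtual, strands in the same direction: one strand crosses the other
  and crosses back, both crossings being virtual or the same strand being over at both. -/
  | two_parallel (x y : Visit Kind) (u v : List (Visit Kind))
      (side : y.side = !x.side) (kind : y.kind = x.kind.opp) :
      Move (u ++ v) ([x, y] ++ u ++ [x.flip, y.flip] ++ v)
  /-- Second move, classical or virtual, strands in opposite directions. -/
  | two_antiparallel (x y : Visit Kind) (u v : List (Visit Kind))
      (side : y.side = !x.side) (kind : y.kind = x.kind.opp) :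
      Move (u ++ v) ([x, y] ++ u ++ [y.flip, x.flip] ++ v)
  /-- Third move, classical or virtual, the strands being met in the cyclic order 1, 2, 3. -/
  | three (a b c : Visit Kind) (e₁ e₂ e₃ : Bool) (h : IsTriangle a b c e₁ e₂ e₃)
      (u v w : List (Visit Kind)) :
      Move (ordered e₁ a b ++ u ++ ordered e₂ a.flip c ++ v ++ ordered e₃ b.flip c.flip ++ w)
        (ordered (!e₁) a b ++ u ++ ordered (!e₂) a.flip c ++ v
          ++ ordered (!e₃) b.flip c.flip ++ w)
  /-- Third move, classical or virtual, the strands being met in the cyclic order 1, 3, 2. -/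
  | three' (a b c : Visit Kind) (e₁ e₂ e₃ : Bool) (h : IsTriangle a b c e₁ e₂ e₃)
      (u v w : List (Visit Kind)) :
      Move (ordered e₁ a b ++ u ++ ordered e₃ b.flip c.flip ++ v ++ ordered e₂ a.flip c ++ w)
        (ordered (!e₁) a b ++ u ++ ordered (!e₃) b.flip c.flip ++ v
          ++ ordered (!e₂) a.flip c ++ w)

/-- Equivalence of virtual knot diagrams, generated by the moves between (planar) diagrams. -/
def diagramSetoid : Setoid VirtualDiagram :=
  Relation.EqvGen.setoid fun D D' => Move D.word D'.word

/-- A virtual knot is an equivalence class of virtual knot diagrams. -/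
def VirtualKnot := Quotient diagramSetoid

/-- The virtual knot of a diagram. -/
def VirtualDiagram.knot (D : VirtualDiagram) : VirtualKnot := Quotient.mk diagramSetoid D

/-- The number of virtual crossings of a diagram (each has exactly one visit of side `true`). -/
def VirtualDiagram.virtualCount (D : VirtualDiagram) : ℕ :=
  D.word.countP fun x => decide (x.kind = .virt) && x.side

/-- The virtual crossing number of a virtual knot: the minimum over all its diagrams. -/
noncomputable def VirtualKnot.virtualCrossingNumber (K : VirtualKnot) : ℕ :=
  sInf {k | ∃ D : VirtualDiagram, D.knot = K ∧ D.virtualCount = k}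

/-- A virtual knot is classical if its virtual crossing number is 0. -/
def VirtualKnot.IsClassical (K : VirtualKnot) : Prop := K.virtualCrossingNumber = 0

/-- A virtual knot is non-classical if its virtual crossing number is at least 1. -/
def VirtualKnot.IsNonClassical (K : VirtualKnot) : Prop := 1 ≤ K.virtualCrossingNumber

/-- Determine a crossing type: a precrossing gets type `k`, all others keep theirs. -/
def PseudoKind.resolve (k : Kind) : PseudoKind → Kind
  | .determined k' => k'
  | .pre => k

/-- Resolve a visit, using `r` for the precrossings. -/
def Visit.resolve (r : ℕ → Kind) (x : Visit PseudoKind) : Visit Kind :=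
  ⟨x.crossing, x.side, x.kind.resolve (r x.crossing)⟩

theorem map_pass_resolve (r : ℕ → Kind) (l : List (Visit PseudoKind)) :
    (l.map (Visit.resolve r)).map Visit.pass = l.map Visit.pass := by
  rw [List.map_map]
  rfl

namespace UberVirtualPseudodiagram

/-- The resolution of a pseudodiagram in which every precrossing `c` becomes a crossing of type
`r c`, that is, virtual, positive or negative. -/
def resolve (P : UberVirtualPseudodiagram) (r : ℕ → Kind) : VirtualDiagram where
  word := P.word.map (Visit.resolve r)
  nodup := by rw [map_pass_resolve]; exact P.nodup
  flip_mem := by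
    intro x hx
    obtain ⟨y, hy, rfl⟩ := List.mem_map.1 hx
    exact List.mem_map.2 ⟨y.flip, P.flip_mem y hy, rfl⟩
  planar := by rw [map_pass_resolve]; exact P.planar

/-- `c` is a precrossing of `P`. -/
def IsPrecrossing (P : UberVirtualPseudodiagram) (c : ℕ) : Prop :=
  ∃ x ∈ P.word, x.crossing = c ∧ x.kind = .pre

/-- The chord diagram: the cyclic word of the endpoints of the chords, one chord for each classical
crossing and each precrossing; virtual crossings are not recorded. -/
def chordDiagram (P : UberVirtualPseudodiagram) : List ℕ :=
  (P.word.filter fun x => decide (x.kind ≠ .determined .virt)).map Visit.crossing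

/-- The chords `a` and `b` intersect: their endpoints alternate on the circle. (Every chord has two
endpoints, so this fails for `a = b`.) -/
def ChordsIntersect (P : UberVirtualPseudodiagram) (a b : ℕ) : Prop :=
  [a, b, a, b].Sublist P.chordDiagram ∨ [b, a, b, a].Sublist P.chordDiagram

end UberVirtualPseudodiagram

end VirtualKnots

/-! The invariant is the odd writhe: the sum of the signs of those classical crossings whose two
visits are separated by an odd number of visits to classical crossings. `oddWrithe` computes its
double from parity tags: each visit carries the parity of the number of classical visits before it,
and a classical crossing is odd exactly when its two tags agree. The odd writhe is unchanged by
every Reidemeister move (`oddWrithe_eq_of_knot_eq`).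

It vanishes on diagrams without virtual crossings (`oddWrithe_eq_zero`). By Gauss's parity condition
every crossing of a plane curve is even. This comes from a checkerboard colouring: on a surface of
Euler characteristic 2 every mod 2 cycle bounds, in particular the whole curve
(`exists_alternating_coloring`). A nonzero odd writhe therefore forces a non-classical knot.

Now make all precrossings other than `a` and `b` virtual. The chords intersect, so exactly one visit
of `b` lies between the visits of `a`, and the choice of `b` as virtual or classical decides whether
`a` is odd. Choose it so that `a` is odd. The two signs of `a` leave all parities alone but give
different odd writhes, so at least one is nonzero. -/

namespace VirtualKnots

/-! ### Mod 2 homology of the curve on the sphere and Gauss's parity condition. -/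

section FaceColoring

variable {X : Type*} (next : Equiv.Perm X) (flip : X → X) (side : X → Bool)

/-- `faceStep` for an abstract set of passes. -/
def turn (d : X × Bool) : X × Bool :=
  let q := if d.2 then next d.1 else next.symm d.1
  (flip q, d.2 == side q)

/-- The faces of an abstract set of passes. -/
abbrev Face := Quot fun d e : X × Bool => e = turn next flip side d

/-- The face on the left of a half-edge. -/
abbrev leftFace (d : X × Bool) : Face next flip side := Quot.mk _ d

variable {next flip side}

theorem leftFace_turn (d : X × Bool) :
    leftFace next flip side (turn next flip side d) = leftFace next flip side d :=
  (Quot.sound (r := fun d e : X × Bool => e = turn next flip side d) rfl).symm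

/-- This and the next three lemmas identify the faces at the corners of a crossing: a corner lies to
the left of one edge end arriving there and of one leaving. -/
theorem leftFace_into_true {q : X} (hq : side q = true) :
    leftFace next flip side (flip q, true) = leftFace next flip side (next.symm q, true) := by
  rw [← leftFace_turn (next.symm q, true)]
  simp [turn, hq]

theorem leftFace_back_true {q : X} (hq : side q = true) :
    leftFace next flip side (flip q, false) = leftFace next flip side (next q, false) := by
  rw [← leftFace_turn (next q, false)]
  simp [turn, hq]

theorem leftFace_into_false {q : X} (hq : side q = false) :
    leftFace next flip side (flip q, false) = leftFace next flip side (next.symm q, true) := by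
  rw [← leftFace_turn (next.symm q, true)]
  simp [turn, hq]

theorem leftFace_back_false {q : X} (hq : side q = false) :
    leftFace next flip side (flip q, true) = leftFace next flip side (next q, false) := by
  rw [← leftFace_turn (next q, false)]
  simp [turn, hq]

variable (next flip side) in
/-- The boundary of a mod 2 chain of faces; the edge from `p` to `next p` is named `p`. -/
def faceBoundary : (Face next flip side → ZMod 2) →ₗ[ZMod 2] (X → ZMod 2) where
  toFun A p := A (leftFace next flip side (p, true)) + A (leftFace next flip side (next p, false))
  map_add' A B := by ext p; simp only [Pi.add_apply]; ring
  map_smul' c A := by ext p; simp only [Pi.smul_apply, smul_eq_mul, RingHom.id_apply]; ring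

variable (next flip) in
/-- The boundary of a mod 2 chain of edges, as a function of the passes through the vertices. -/
def edgeBoundary : (X → ZMod 2) →ₗ[ZMod 2] (X → ZMod 2) where
  toFun z q := z q + z (next.symm q) + (z (flip q) + z (next.symm (flip q)))
  map_add' A B := by ext p; simp only [Pi.add_apply]; ring
  map_smul' c A := by ext p; simp only [Pi.smul_apply, smul_eq_mul, RingHom.id_apply]; ring

section

variable (flip_flip : ∀ x, flip (flip x) = x) (side_flip : ∀ x, side (flip x) = !side x)
include flip_flip side_flip

/-- A chain of faces with constant boundary `t` changes by `t` along the curve and between the two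
strands of a crossing. -/
theorem faceChain_step {A : Face next flip side → ZMod 2} {t : ZMod 2}
    (h : ∀ p, faceBoundary next flip side A p = t) (q : X) :
    A (leftFace next flip side (next q, true)) = A (leftFace next flip side (q, true)) + t ∧
      A (leftFace next flip side (flip q, true)) = A (leftFace next flip side (q, true)) + t := by
  have two : ∀ x : ZMod 2, x + x = 0 := CharTwo.add_self_eq_zero
  have h' : ∀ p, A (leftFace next flip side (next p, false)) =
      A (leftFace next flip side (p, true)) + t := fun p => by
    have := h p
    simp only [faceBoundary, LinearMap.coe_mk, AddHom.coe_mk] at this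
    rw [← this, ← add_assoc, two, zero_add]
  have h'' : ∀ p, A (leftFace next flip side (p, false)) =
      A (leftFace next flip side (next.symm p, true)) + t := fun p => by
    rw [← h', Equiv.apply_symm_apply]
  -- It is enough to treat side `true`: the two passes of a crossing have opposite sides, and `flip`
  -- exchanges them.
  have key : ∀ q, side q = true →
      A (leftFace next flip side (flip q, true)) = A (leftFace next flip side (next.symm q, true)) ∧
      A (leftFace next flip side (q, true)) = A (leftFace next flip side (next.symm q, true)) + t ∧
      A (leftFace next flip side (flip q, true)) =
        A (leftFace next flip side (next.symm (flip q), true)) + t := by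
    intro q hq
    have hq' : side (flip q) = false := by rw [side_flip, hq]; rfl
    have e1 := congrArg A (leftFace_into_true (next := next) (flip := flip) hq)
    have e2 := congrArg A (leftFace_back_true (next := next) (flip := flip) hq)
    have e3 := congrArg A (leftFace_into_false (next := next) hq')
    rw [flip_flip] at e3
    rw [h'', h'] at e2
    rw [h''] at e3
    refine ⟨e1, ?_, ?_⟩
    · rw [e3]; exact (add_right_cancel e2).symm
    · rw [e1, ← e3, add_assoc, two, add_zero]
  constructor
  · cases hq : side (next q)
    · have := (key (flip (next q)) (by rw [side_flip, hq]; rfl)).2.2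
      rwa [flip_flip, Equiv.symm_apply_apply] at this
    · have := (key (next q) hq).2.1
      rwa [Equiv.symm_apply_apply] at this
  · cases hq : side q
    · obtain ⟨h1, h2, -⟩ := key (flip q) (by rw [side_flip, hq]; rfl)
      rw [flip_flip] at h1
      rw [h2, h1]
    · obtain ⟨h1, h2, -⟩ := key q hq
      rw [h2, h1, add_assoc, two, add_zero]

/-- Each of the four corners at a crossing touches two of the four edge ends, so its face is counted
twice, which is 0 mod 2. -/
theorem edgeBoundary_faceBoundary (A : Face next flip side → ZMod 2) :
    edgeBoundary next flip (faceBoundary next flip side A) = 0 := by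
  have key : ∀ q, side q = true →
      edgeBoundary next flip (faceBoundary next flip side A) q = 0 := by
    intro q hq
    have hq' : side (flip q) = false := by rw [side_flip, hq]; rfl
    have e1 := congrArg A (leftFace_into_true (next := next) (flip := flip) hq)
    have e2 := congrArg A (leftFace_back_true (next := next) (flip := flip) hq)
    have e3 := congrArg A (leftFace_into_false (next := next) hq')
    have e4 := congrArg A (leftFace_back_false (next := next) hq')
    rw [flip_flip] at e3 e4
    simp only [edgeBoundary, faceBoundary, LinearMap.coe_mk, AddHom.coe_mk,
      Equiv.apply_symm_apply]
    rw [← e1, ← e2, ← e3, ← e4]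
    linear_combination (A (leftFace next flip side (q, true)) +
      A (leftFace next flip side (q, false)) + A (leftFace next flip side (flip q, true)) +
      A (leftFace next flip side (flip q, false))) * (CharTwo.two_eq_zero : (2 : ZMod 2) = 0)
  ext q
  cases hq : side q
  · have := key (flip q) (by rw [side_flip, hq]; rfl)
    simp only [edgeBoundary, LinearMap.coe_mk, AddHom.coe_mk, flip_flip, Pi.zero_apply] at this ⊢
    rw [← this, add_comm]
  · exact key q hq

/-- Gauss's parity condition: on a curve of genus 0, the passes can be two-coloured such that the
colour changes at every step along the curve, and the two passes of a crossing differ in colour. -/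
theorem exists_alternating_coloring [Fintype X]
    (trans : ∀ f : X → ZMod 2, (∀ x, f (next x) = f x) → ∀ x y, f x = f y)
    (card : 2 * Nat.card (Face next flip side) = Fintype.card X + 4) :
    ∃ o : X → Bool, ∀ x, o (next x) = !o x ∧ o (flip x) = !o x := by
  rcases isEmpty_or_nonempty X with hX | ⟨⟨x₀⟩⟩
  · exact ⟨fun _ => false, fun x => hX.elim x⟩
  have two : ∀ x : ZMod 2, x + x = 0 := CharTwo.add_self_eq_zero
  have : Finite (Face next flip side) := Quot.finite _
  let _ : Fintype (Face next flip side) := Fintype.ofFinite _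
  let D := faceBoundary next flip side
  let W := edgeBoundary next flip
  -- A face chain without boundary is constant, since the curve is connected and passes every face;
  -- its value at one face determines it.
  have hker : Module.finrank (ZMod 2) (LinearMap.ker D) ≤ 1 := by
    let ev : LinearMap.ker D →ₗ[ZMod 2] ZMod 2 :=
      (LinearMap.proj (leftFace next flip side (x₀, true))).comp (LinearMap.ker D).subtype
    have inj : Function.Injective ev := by
      rw [← LinearMap.ker_eq_bot, LinearMap.ker_eq_bot']
      rintro ⟨A, hA⟩ h0
      have h0 : A (leftFace next flip side (x₀, true)) = 0 := h0
      have hA' : ∀ p, faceBoundary next flip side A p = 0 := fun p => congrFun hA p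
      have hs := fun q => (faceChain_step flip_flip side_flip hA' q).1
      simp only [add_zero] at hs
      have ht : ∀ x, A (leftFace next flip side (x, true)) = 0 := fun x =>
        (trans (fun x => A (leftFace next flip side (x, true))) hs x x₀).trans h0
      have hf : ∀ x, A (leftFace next flip side (x, false)) = 0 := fun x => by
        have := hA' (next.symm x)
        simpa [faceBoundary, ht] using this
      apply Subtype.ext
      funext F
      obtain ⟨⟨x, b⟩, rfl⟩ := Quot.exists_rep F
      cases b
      · exact hf x
      · exact ht x
    simpa using LinearMap.finrank_le_finrank_of_injective inj
  -- With `n` crossings the cycle space has dimension at most `n + 1`. A cycle is determined by its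
  -- value on one edge and its jump along one strand of each crossing: the cycle condition gives the
  -- jump along the other strand.
  have hW : 2 * Module.finrank (ZMod 2) (LinearMap.ker W) ≤ Fintype.card X + 2 := by
    let jump : (X → ZMod 2) →ₗ[ZMod 2] ZMod 2 × ({q // side q = true} → ZMod 2) :=
      { toFun := fun z => (z x₀, fun q => z q.1 + z (next.symm q.1))
        map_add' := fun y z => Prod.ext rfl (by
          funext q; simp only [Pi.add_apply, Prod.snd_add]; ring)
        map_smul' := fun c z => Prod.ext rfl (by funext q; simp [mul_add]) }
    have inj : Function.Injective (jump.comp (LinearMap.ker W).subtype) := by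
      rw [← LinearMap.ker_eq_bot, LinearMap.ker_eq_bot']
      rintro ⟨z, hz⟩ h0
      have h0 : jump z = 0 := h0
      have h1 : z x₀ = 0 := congrArg Prod.fst h0
      have h2 : ∀ q, side q = true → z q + z (next.symm q) = 0 := fun q hq =>
        congrFun (congrArg Prod.snd h0) ⟨q, hq⟩
      have h3 : ∀ q, z q + z (next.symm q) = 0 := by
        intro q
        cases hq : side q
        · have h4 : z q + z (next.symm q) + (z (flip q) + z (next.symm (flip q))) = 0 :=
            congrFun hz q
          rwa [h2 (flip q) (by rw [side_flip, hq]; rfl), add_zero] at h4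
        · exact h2 q hq
      apply Subtype.ext
      funext x
      refine (trans z (fun x => ?_) x x₀).trans h1
      have := h3 (next x)
      rw [Equiv.symm_apply_apply] at this
      exact CharTwo.add_eq_zero.1 this
    have hle := LinearMap.finrank_le_finrank_of_injective inj
    have hcard : 2 * Fintype.card {q // side q = true} = Fintype.card X := by
      have e : {q // side q = true} ≃ {q // ¬ side q = true} :=
        { toFun := fun q => ⟨flip q.1, by simp [side_flip, q.2]⟩
          invFun := fun q => ⟨flip q.1, by simpa [side_flip] using q.2⟩
          left_inv := fun q => Subtype.ext (flip_flip _)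
          right_inv := fun q => Subtype.ext (flip_flip _) }
      have := Fintype.card_subtype_compl (fun q => side q = true)
      have := Fintype.card_congr e
      have := Fintype.card_subtype_le (fun q => side q = true)
      omega
    rw [Module.finrank_prod, Module.finrank_self, Module.finrank_fintype_fun_eq_card] at hle
    omega
  have hle : LinearMap.range D ≤ LinearMap.ker W := by
    rintro _ ⟨A, rfl⟩
    exact edgeBoundary_faceBoundary flip_flip side_flip A
  have hrank := LinearMap.finrank_range_add_finrank_ker D
  rw [Module.finrank_fintype_fun_eq_card, ← Nat.card_eq_fintype_card] at hrank
  -- With `n + 2` faces the boundaries have dimension at least `n + 1`, the bound for the cycles, so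
  -- every cycle bounds.
  have heq := Submodule.eq_of_le_of_finrank_le hle (by omega)
  -- The whole curve is a cycle. A face chain that it bounds is a checkerboard colouring, and the
  -- colour on the left of the curve is the desired `o`.
  have hone : (fun _ => 1 : X → ZMod 2) ∈ LinearMap.ker W := by
    rw [LinearMap.mem_ker]
    funext x
    simp [W, edgeBoundary, two]
  rw [← heq] at hone
  obtain ⟨A, hA⟩ := hone
  have bool : ∀ {y z : ZMod 2}, y = z + 1 → decide (y = 0) = !decide (z = 0) := by decide
  refine ⟨fun x => decide (A (leftFace next flip side (x, true)) = 0), fun x => ?_⟩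
  have hx := faceChain_step flip_flip side_flip (fun p => congrFun hA p) x
  exact ⟨bool hx.1, bool hx.2⟩

end

end FaceColoring

/-! ### Parity counts along a word. -/

section ParityTag

variable {α β : Type*} (p : α → Bool)

/-- The parity of the number of letters that satisfy `p`. -/
def oddCount : List α → Bool
  | [] => false
  | x :: l => (p x ^^ oddCount l)

/-- Tag each letter with the parity of the number of letters before it that satisfy `p`, the count
starting at `e`. -/
def parityTag : Bool → List α → List (α × Bool)
  | _, [] => []
  | e, x :: l => (x, e) :: parityTag (e ^^ p x) l

theorem oddCount_append (u v : List α) :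
    oddCount p (u ++ v) = (oddCount p u ^^ oddCount p v) := by
  induction u with
  | nil => simp [oddCount]
  | cons x u ih => simp [oddCount, ih]

theorem oddCount_perm {u v : List α} (h : u.Perm v) : oddCount p u = oddCount p v := by
  induction h with
  | nil => rfl
  | cons x _ ih => simp [oddCount, ih]
  | swap x y l => simp [oddCount, Bool.xor_left_comm]
  | trans _ _ ih₁ ih₂ => exact ih₁.trans ih₂

theorem oddCount_map (g : β → α) (u : List β) :
    oddCount p (u.map g) = oddCount (fun x => p (g x)) u := by
  induction u with
  | nil => rfl
  | cons x u ih => simp [oddCount, ih]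

theorem oddCount_xor (q : α → Bool) (u : List α) :
    oddCount (fun x => p x ^^ q x) u = (oddCount p u ^^ oddCount q u) := by
  induction u with
  | nil => rfl
  | cons x u ih => simp [oddCount, ih, Bool.xor_left_comm]

theorem oddCount_congr {q : α → Bool} {u : List α} (h : ∀ x ∈ u, p x = q x) :
    oddCount p u = oddCount q u := by
  induction u with
  | nil => rfl
  | cons x u ih =>
    simp only [List.forall_mem_cons] at h
    simp [oddCount, ih h.2, h.1]

theorem parityTag_append (e : Bool) (u v : List α) :
    parityTag p e (u ++ v) = parityTag p e u ++ parityTag p (e ^^ oddCount p u) v := by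
  induction u generalizing e with
  | nil => simp [oddCount, parityTag]
  | cons x u ih => simp [oddCount, parityTag, ih]

theorem parityTag_not (e : Bool) (u : List α) :
    parityTag p (!e) u = (parityTag p e u).map (Prod.map id not) := by
  induction u generalizing e with
  | nil => rfl
  | cons x u ih => simp [parityTag, ← ih]

theorem parityTag_map (g : β → α) (e : Bool) (u : List β) :
    parityTag p e (u.map g) = (parityTag (fun x => p (g x)) e u).map (Prod.map g id) := by
  induction u generalizing e with
  | nil => rfl
  | cons x u ih => simp [parityTag, ih]

variable {p} in
theorem mem_of_mem_parityTag {e : Bool} {u : List α} {t : α × Bool} (h : t ∈ parityTag p e u) :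
    t.1 ∈ u := by
  induction u generalizing e with
  | nil => simp [parityTag] at h
  | cons x u ih =>
    rcases List.mem_cons.1 h with rfl | h
    · exact List.mem_cons_self
    · exact List.mem_cons_of_mem _ (ih h)

/-- If `o` alternates along a word all of whose letters are counted, then it is the tag, up to a
constant. -/
theorem parityTag_eq_of_isChain {o : α → Bool} {e k : Bool} {u : List α} (hp : ∀ x ∈ u, p x = true)
    (hu : u.IsChain fun x y => o y = !o x) (hk : ∀ x ∈ u.head?, o x = (k ^^ e))
    {t : α × Bool} (ht : t ∈ parityTag p e u) : o t.1 = (k ^^ t.2) := by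
  induction u generalizing e with
  | nil => simp [parityTag] at ht
  | cons x u ih =>
    have hx : o x = (k ^^ e) := hk x rfl
    rcases List.mem_cons.1 ht with rfl | ht
    · exact hx
    · rw [List.isChain_cons] at hu
      refine ih (fun y hy => hp y (List.mem_cons_of_mem _ hy)) hu.2 (fun y hy => ?_) ht
      rw [hu.1 y hy, hx, hp x List.mem_cons_self]
      simp

end ParityTag

/-! ### Gauss's parity condition for planar words. -/

section Planar

theorem Pass.flip_flip (p : Pass) : p.flip.flip = p := by simp [Pass.flip]

theorem isPlanar_coloring {s : List Pass} (nodup : s.Nodup) (flip_mem : ∀ p ∈ s, p.flip ∈ s)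
    (planar : IsPlanar s) :
    ∃ o : Pass → Bool, s.IsChain (fun p q => o q = !o p) ∧ ∀ p ∈ s, o p.flip = !o p := by
  rcases planar with rfl | planar
  · exact ⟨fun _ => false, by simp, by simp⟩
  let X := {p : Pass // p ∈ s}
  let next : Equiv.Perm X := s.formPerm.subtypePerm fun x => List.formPerm_mem_iff_mem
  let flip : X → X := fun p => ⟨p.1.flip, flip_mem p.1 p.2⟩
  let side : X → Bool := fun p => p.1.2
  have next_get : ∀ i (hi : i + 1 < s.length),
      next ⟨s[i], List.getElem_mem _⟩ = ⟨s[i + 1], List.getElem_mem _⟩ := fun i hi => by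
    apply Subtype.ext
    change s.formPerm s[i] = s[i + 1]
    rw [List.formPerm_apply_getElem _ nodup]
    simp only [Nat.mod_eq_of_lt hi]
  let e : HalfEdgeOf s ≃ X × Bool :=
    { toFun := fun d => (⟨d.1.1, d.2⟩, d.1.2)
      invFun := fun d => ⟨(d.1.1, d.2), d.1.2⟩
      left_inv := fun _ => rfl
      right_inv := fun _ => rfl }
  have step : ∀ d, ((e.symm (turn next flip side d) : HalfEdgeOf s) : HalfEdge) =
      faceStep s (e.symm d) := by
    rintro ⟨p, b⟩
    cases b <;> rfl
  have faces : faceCount s = Nat.card (Face next flip side) := by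
    refine Nat.card_congr (Quot.congr e fun d d' => ?_)
    rw [← e.symm_apply_apply d, ← step, e.apply_symm_apply]
    constructor
    · intro h
      rw [← e.symm.injective.eq_iff, e.symm_apply_apply]
      exact Subtype.ext h
    · intro h
      rw [← h, e.symm_apply_apply]
  have cardX : Fintype.card X = s.length := by
    rw [← List.toFinset_card_of_nodup nodup, ← Fintype.card_coe]
    exact Fintype.card_congr (Equiv.subtypeEquivRight fun _ => List.mem_toFinset.symm)
  obtain ⟨o, ho⟩ := exists_alternating_coloring (next := next) (flip := flip) (side := side)
    -- A function invariant under `next` is constant because the word is a single cycle.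
    (fun x => Subtype.ext (Pass.flip_flip _)) (fun _ => rfl) (fun f hf => by
      have h0 : ∀ i (hi : i < s.length), f ⟨s[i], List.getElem_mem _⟩ =
          f ⟨s[0]'(by omega), List.getElem_mem _⟩ := by
        intro i
        induction i with
        | zero => intro _; rfl
        | succ i ih => intro hi; rw [← next_get i hi, hf, ih]
      have h1 : ∀ x y : X, f x = f y := by
        rintro ⟨x, hx⟩ ⟨y, hy⟩
        obtain ⟨i, hi, rfl⟩ := List.getElem_of_mem hx
        obtain ⟨j, hj, rfl⟩ := List.getElem_of_mem hy
        rw [h0 i hi, h0 j hj]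
      exact h1) (by rw [← faces, planar, cardX])
  have ext : ∀ p (hp : p ∈ s), (if h : p ∈ s then o ⟨p, h⟩ else false) = o ⟨p, hp⟩ :=
    fun p hp => dif_pos hp
  refine ⟨fun p => if h : p ∈ s then o ⟨p, h⟩ else false, ?_, fun p hp => ?_⟩
  · rw [List.isChain_iff_getElem]
    intro i hi
    beta_reduce
    rw [ext _ (List.getElem_mem _), ext _ (List.getElem_mem _), ← next_get i hi, (ho _).1]
  · beta_reduce
    rw [ext _ hp, ext _ (flip_mem p hp)]
    exact (ho ⟨p, hp⟩).2

end Planar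

/-! ### The odd writhe. -/

/-- The sign of a classical crossing, and 0 for a virtual one. -/
def Kind.sign : Kind → ℤ
  | .virt => 0
  | .pos => 1
  | .neg => -1

/-- The visit is of a classical crossing. -/
def Visit.isClassical (x : Visit Kind) : Bool := decide (x.kind ≠ .virt)

theorem Visit.isClassical_flip (x : Visit Kind) : x.flip.isClassical = x.isClassical := rfl

theorem Visit.crossing_flip {T : Type} (x : Visit T) : x.flip.crossing = x.crossing := rfl

theorem Visit.flip_flip {T : Type} (x : Visit T) : x.flip.flip = x := by simp [Visit.flip]

/-- The sign of the crossing if `t` and `t'` are its two visits and have equal tags, else 0. -/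
def pairWeight (t t' : Visit Kind × Bool) : ℤ :=
  if t'.1.crossing = t.1.crossing ∧ t'.1.side = (!t.1.side) ∧ t'.2 = t.2 then t.1.kind.sign else 0

/-- The sum of the weights of all pairs. -/
def pairSum (M : Multiset (Visit Kind × Bool)) : ℤ :=
  (M.map fun t => (M.map (pairWeight t)).sum).sum

/-- Twice the odd writhe: the sum over all visits of odd classical crossings of their signs. -/
def oddWrithe (w : List (Visit Kind)) : ℤ :=
  pairSum (parityTag Visit.isClassical false w)

/-- The contribution of a crossing to `oddWrithe`, if its tags differ by `d`. -/
def chordWeight (x : Visit Kind) (d : Bool) : ℤ := if d then 0 else 2 * x.kind.sign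

theorem pairWeight_eq_zero {t t' : Visit Kind × Bool} (h : t'.1.crossing ≠ t.1.crossing) :
    pairWeight t t' = 0 := if_neg fun h' => h h'.1

theorem pairSum_map (φ : Visit Kind × Bool → Visit Kind × Bool) (M : Multiset (Visit Kind × Bool))
    (h : ∀ t t', pairWeight (φ t) (φ t') = pairWeight t t') : pairSum (M.map φ) = pairSum M := by
  simp [pairSum, h]

/-- Visits of different crossings do not interact, so a chord splits off and only the difference of
its tags matters. The moves are checked by stripping off the chords involved. -/
theorem pairSum_chord (x : Visit Kind) (e e' : Bool) (M : Multiset (Visit Kind × Bool))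
    (h : ∀ t ∈ M, t.1.crossing ≠ x.crossing) :
    pairSum ((x, e) ::ₘ (x.flip, e') ::ₘ M) = chordWeight x (e ^^ e') + pairSum M := by
  have h1 : M.map (pairWeight (x, e)) = M.map fun _ => 0 :=
    Multiset.map_congr rfl fun t ht => pairWeight_eq_zero (h t ht)
  have h2 : M.map (pairWeight (x.flip, e')) = M.map fun _ => 0 :=
    Multiset.map_congr rfl fun t ht => pairWeight_eq_zero (h t ht)
  have h3 : (M.map fun t => (((x, e) ::ₘ (x.flip, e') ::ₘ M).map (pairWeight t)).sum) =
      M.map fun t => (M.map (pairWeight t)).sum :=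
    Multiset.map_congr rfl fun t ht => by
      rw [Multiset.map_cons, Multiset.map_cons, Multiset.sum_cons, Multiset.sum_cons,
        pairWeight_eq_zero (h t ht).symm, pairWeight_eq_zero (t' := (x.flip, e')) (h t ht).symm,
        zero_add, zero_add]
  have h4 : ∀ (y : Visit Kind) (b : Bool), pairWeight (y, b) (y, b) = 0 := fun y b => by
    simp [pairWeight]
  have h5 : pairWeight (x, e) (x.flip, e') + pairWeight (x.flip, e') (x, e) =
      chordWeight x (e ^^ e') := by
    cases e <;> cases e' <;> simp [pairWeight, chordWeight, Visit.flip, two_mul]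
  rw [← h5]
  unfold pairSum
  simp only [Multiset.map_cons, Multiset.sum_cons] at h3 ⊢
  simp only [h3, h1, h2, h4, Multiset.map_const',
    Multiset.sum_replicate, smul_zero]
  ring

section Valid

variable {T : Type}

theorem side_eq_not_of_nodup {x x' : Visit T} {l : List (Visit T)}
    (hc : x'.crossing = x.crossing) (h : ((x :: x' :: l).map Visit.pass).Nodup) :
    x'.side = !x.side := by
  simp only [List.map_cons, List.nodup_cons, List.mem_cons, not_or] at h
  exact Bool.eq_not_of_ne fun hs => h.1.1 (Prod.ext hc.symm hs.symm)

theorem crossing_ne_of_nodup {x x' : Visit T} {l : List (Visit T)} (hc : x'.crossing = x.crossing)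
    (h : ((x :: x' :: l).map Visit.pass).Nodup) : ∀ y ∈ l, y.crossing ≠ x.crossing := by
  intro y hy hy'
  have hx := side_eq_not_of_nodup hc h
  simp only [List.map_cons, List.nodup_cons, List.mem_cons, List.mem_map, not_or, not_exists,
    not_and] at h
  by_cases hs : y.side = x.side
  · exact h.1.2 y hy (Prod.ext hy' hs)
  · exact h.2.1 y hy (Prod.ext (hy'.trans hc.symm) ((Bool.eq_not_of_ne hs).trans hx.symm))

theorem perm_map_flip {w : List (Visit T)} (nodup : (w.map Visit.pass).Nodup)
    (flip_mem : ∀ x ∈ w, x.flip ∈ w) : (w.map Visit.flip).Perm w := by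
  refine (List.perm_ext_iff_of_nodup ((List.nodup_map_iff ?_).2 nodup.of_map) nodup.of_map).2
    fun x => ⟨fun hx => ?_, fun hx => List.mem_map.2 ⟨_, flip_mem x hx, x.flip_flip⟩⟩
  · exact fun x y h => by rw [← x.flip_flip, h, y.flip_flip]
  · obtain ⟨y, hy, rfl⟩ := List.mem_map.1 hx
    exact flip_mem y hy

end Valid

/-- `flip` matches the classical visits of side `true` with those of side `false`, so the total is
even. This makes crossing parity well defined on cyclic words. -/
theorem oddCount_isClassical {w : List (Visit Kind)} (nodup : (w.map Visit.pass).Nodup)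
    (flip_mem : ∀ x ∈ w, x.flip ∈ w) : oddCount Visit.isClassical w = false := by
  have h1 : Visit.isClassical =
      fun x => (x.isClassical && x.side) ^^ (x.isClassical && !x.side) := by
    funext x
    cases x.isClassical <;> cases x.side <;> rfl
  have h2 := oddCount_perm (fun x => x.isClassical && x.side) (perm_map_flip nodup flip_mem)
  rw [oddCount_map] at h2
  rw [h1, oddCount_xor, ← h2]
  exact Bool.xor_self _

/-! ### Invariance of the odd writhe under the moves. -/

theorem oddWrithe_rotate (u v : List (Visit Kind))
    (h : oddCount Visit.isClassical (u ++ v) = false) : oddWrithe (u ++ v) = oddWrithe (v ++ u) := by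
  rw [oddCount_append] at h
  unfold oddWrithe
  rw [parityTag_append, parityTag_append]
  cases hu : oddCount Visit.isClassical u <;> cases hv : oddCount Visit.isClassical v <;>
    simp only [hu, hv, Bool.xor_false, Bool.xor_true, Bool.not_false,
      Bool.true_eq_false] at h ⊢
  · exact congrArg pairSum (Multiset.coe_eq_coe.2 List.perm_append_comm)
  -- Both halves are odd here, so the rotation complements every tag; weights only compare tags.
  · rw [← pairSum_map (Prod.map id not) _ (fun t t' => by simp [pairWeight])]
    have e1 := parityTag_not Visit.isClassical false u
    have e2 := parityTag_not Visit.isClassical true v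
    simp only [Bool.not_false, Bool.not_true] at e1 e2
    rw [e1, e2, Multiset.map_coe, List.map_append]
    exact congrArg pairSum (Multiset.coe_eq_coe.2 List.perm_append_comm)

theorem oddWrithe_rename (σ : Equiv.Perm ℕ) (u : List (Visit Kind)) :
    oddWrithe (u.map (Visit.rename σ)) = oddWrithe u := by
  unfold oddWrithe
  rw [parityTag_map, ← Multiset.map_coe]
  exact pairSum_map _ _ fun t t' => by simp [pairWeight, Visit.rename]

theorem crossing_ne_of_mem_parityTag {p : Visit Kind → Bool} {e : Bool} {u l : List (Visit Kind)}
    {n : ℕ} (h : ∀ y ∈ l, y.crossing ≠ n) (hu : ∀ y ∈ u, y ∈ l) :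
    ∀ t ∈ parityTag p e u, t.1.crossing ≠ n :=
  fun _ ht => h _ (hu _ (mem_of_mem_parityTag ht))

/-- A classical kink has no visit between its own two, hence is even; a virtual one has sign 0.
Either way the two letters leave the later tags unchanged. -/
theorem oddWrithe_kink (x : Visit Kind) (u : List (Visit Kind))
    (nodup : (([x, x.flip] ++ u).map Visit.pass).Nodup) :
    oddWrithe ([x, x.flip] ++ u) = oddWrithe u := by
  have h := crossing_ne_of_nodup (Visit.crossing_flip _) nodup
  have e : (parityTag Visit.isClassical false ([x, x.flip] ++ u) : Multiset _) =
      (x, false) ::ₘ (x.flip, x.isClassical) ::ₘ ↑(parityTag Visit.isClassical false u) := by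
    simp [parityTag, Visit.isClassical_flip]
  unfold oddWrithe
  rw [e, pairSum_chord _ _ _ _ fun t ht => crossing_ne_of_mem_parityTag h (fun _ hy => hy) t ht]
  cases hx : x.kind <;> simp [chordWeight, hx, Visit.isClassical, Kind.sign]

/-- The two chords have the same parity and opposite signs (or are both virtual), so they cancel. -/
theorem pairSum_bigon (x y : Visit Kind) (e₁ e₂ f₁ f₂ : Bool) (l : List (Visit Kind))
    (M : Multiset (Visit Kind × Bool)) (hM : ∀ t ∈ M, t.1 ∈ l)
    (nodup : ((x :: x.flip :: y :: y.flip :: l).map Visit.pass).Nodup)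
    (kind : y.kind = x.kind.opp) (h : (e₁ ^^ e₂) = (f₁ ^^ f₂)) :
    pairSum ((x, e₁) ::ₘ (x.flip, e₂) ::ₘ (y, f₁) ::ₘ (y.flip, f₂) ::ₘ M) = pairSum M := by
  have hx := crossing_ne_of_nodup (Visit.crossing_flip _) nodup
  have hy := crossing_ne_of_nodup (Visit.crossing_flip _) (nodup.sublist (((List.sublist_cons_self _ _).trans
    (List.sublist_cons_self _ _)).map _))
  rw [pairSum_chord, pairSum_chord, h]
  · cases hk : x.kind <;> rw [hk] at kind <;> cases (f₁ ^^ f₂) <;>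
      simp [chordWeight, kind, hk, Kind.sign, Kind.opp]
  · exact fun t ht => hy _ (hM t ht)
  · intro t ht
    rcases Multiset.mem_cons.1 ht with rfl | ht
    · exact hx _ (by simp)
    rcases Multiset.mem_cons.1 ht with rfl | ht
    · exact hx _ (by simp)
    · exact hx _ (by simp [hM t ht])

theorem isClassical_of_kind_eq_opp {x y : Visit Kind} (kind : y.kind = x.kind.opp) :
    y.isClassical = x.isClassical := by
  cases hk : x.kind <;> rw [hk] at kind <;> simp [Visit.isClassical, hk, kind, Kind.opp]

theorem oddWrithe_two_parallel (x y : Visit Kind) (u v : List (Visit Kind))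
    (kind : y.kind = x.kind.opp)
    (nodup : (([x, y] ++ u ++ [x.flip, y.flip] ++ v).map Visit.pass).Nodup) :
    oddWrithe ([x, y] ++ u ++ [x.flip, y.flip] ++ v) = oddWrithe (u ++ v) := by
  have hy := isClassical_of_kind_eq_opp kind
  have perm : ([x, y] ++ u ++ [x.flip, y.flip] ++ v).Perm
      (x :: x.flip :: y :: y.flip :: (u ++ v)) := by
    rw [← Multiset.coe_eq_coe]
    simp only [← Multiset.coe_add, ← Multiset.cons_coe, ← Multiset.singleton_add,
      Multiset.coe_nil]
    abel
  have e : (parityTag Visit.isClassical false ([x, y] ++ u ++ [x.flip, y.flip] ++ v) :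
      Multiset _) = (x, false) ::ₘ (x.flip, oddCount Visit.isClassical u) ::ₘ (y, x.isClassical) ::ₘ
        (y.flip, oddCount Visit.isClassical u ^^ x.isClassical) ::ₘ
          ↑(parityTag Visit.isClassical false (u ++ v)) := by
    simp only [parityTag_append, oddCount_append, parityTag, oddCount, Visit.isClassical_flip, hy,
      Bool.false_xor, Bool.xor_false, Bool.xor_self, ← Multiset.coe_add, ← Multiset.cons_coe,
      ← Multiset.singleton_add, Multiset.coe_nil]
    abel
  unfold oddWrithe
  rw [e]
  refine pairSum_bigon x y _ _ _ _ (u ++ v) _ (fun t ht => mem_of_mem_parityTag ht)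
    ((perm.map _).nodup_iff.1 nodup) kind ?_
  cases x.isClassical <;> simp

theorem oddWrithe_two_antiparallel (x y : Visit Kind) (u v : List (Visit Kind))
    (kind : y.kind = x.kind.opp)
    (nodup : (([x, y] ++ u ++ [y.flip, x.flip] ++ v).map Visit.pass).Nodup) :
    oddWrithe ([x, y] ++ u ++ [y.flip, x.flip] ++ v) = oddWrithe (u ++ v) := by
  have hy := isClassical_of_kind_eq_opp kind
  have perm : ([x, y] ++ u ++ [y.flip, x.flip] ++ v).Perm
      (x :: x.flip :: y :: y.flip :: (u ++ v)) := by
    rw [← Multiset.coe_eq_coe]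
    simp only [← Multiset.coe_add, ← Multiset.cons_coe, ← Multiset.singleton_add,
      Multiset.coe_nil]
    abel
  have e : (parityTag Visit.isClassical false ([x, y] ++ u ++ [y.flip, x.flip] ++ v) :
      Multiset _) = (x, false) ::ₘ (x.flip, oddCount Visit.isClassical u ^^ x.isClassical) ::ₘ
        (y, x.isClassical) ::ₘ (y.flip, oddCount Visit.isClassical u) ::ₘ
          ↑(parityTag Visit.isClassical false (u ++ v)) := by
    simp only [parityTag_append, oddCount_append, parityTag, oddCount, Visit.isClassical_flip, hy,
      Bool.false_xor, Bool.xor_false, Bool.xor_self, ← Multiset.coe_add, ← Multiset.cons_coe,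
      ← Multiset.singleton_add, Multiset.coe_nil]
    abel
  unfold oddWrithe
  rw [e]
  refine pairSum_bigon x y _ _ _ _ (u ++ v) _ (fun t ht => mem_of_mem_parityTag ht)
    ((perm.map _).nodup_iff.1 nodup) kind ?_
  cases x.isClassical <;> simp

theorem parityTag_ordered (p e : Bool) (x y : Visit Kind) :
    (parityTag Visit.isClassical p (ordered e x y) : Multiset _) =
      {(x, p ^^ (!e && y.isClassical))} + {(y, p ^^ (e && x.isClassical))} := by
  cases e
  · rw [add_comm]; simp [ordered, parityTag]; rfl
  · simp [ordered, parityTag]; rfl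

theorem coe_ordered (e : Bool) (x y : Visit Kind) :
    (ordered e x y : Multiset (Visit Kind)) = {x} + {y} := by
  cases e
  · rw [add_comm]; rfl
  · rfl

theorem oddCount_ordered (e : Bool) (x y : Visit Kind) :
    oddCount Visit.isClassical (ordered e x y) = (x.isClassical ^^ y.isClassical) := by
  cases e <;> simp [ordered, oddCount, Bool.xor_comm]

/-- The effect of a third move on the tagged visits does not change the odd writhe. -/
theorem pairSum_triangle {a b c : Visit Kind} {e₁ e₂ e₃ : Bool} (h : IsTriangle a b c e₁ e₂ e₃)
    (p₁ p₂ p₃ : Bool) (l : List (Visit Kind)) (M : Multiset (Visit Kind × Bool))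
    (hM : ∀ t ∈ M, t.1 ∈ l)
    (nodup : ((a :: a.flip :: b :: b.flip :: c :: c.flip :: l).map Visit.pass).Nodup) :
    pairSum (parityTag Visit.isClassical p₁ (ordered (!e₁) a b) +
      parityTag Visit.isClassical p₂ (ordered (!e₂) a.flip c) +
      parityTag Visit.isClassical p₃ (ordered (!e₃) b.flip c.flip) + M) =
    pairSum (parityTag Visit.isClassical p₁ (ordered e₁ a b) +
      parityTag Visit.isClassical p₂ (ordered e₂ a.flip c) +
      parityTag Visit.isClassical p₃ (ordered e₃ b.flip c.flip) + M) := by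
  have ha := crossing_ne_of_nodup (Visit.crossing_flip _) nodup
  have nodup' := nodup.sublist (((List.sublist_cons_self _ _).trans
    (List.sublist_cons_self _ _)).map _)
  have hb := crossing_ne_of_nodup (Visit.crossing_flip _) nodup'
  have hc := crossing_ne_of_nodup (Visit.crossing_flip _) (nodup'.sublist (((List.sublist_cons_self _ _).trans
    (List.sublist_cons_self _ _)).map _))
  have chords : ∀ q₁ q₂ q₃ q₄ q₅ q₆ : Bool,
      pairSum (({(a, q₁)} + {(b, q₂)}) + ({(a.flip, q₃)} + {(c, q₄)}) +
        ({(b.flip, q₅)} + {(c.flip, q₆)}) + M) =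
      chordWeight a (q₁ ^^ q₃) + (chordWeight b (q₂ ^^ q₅) + (chordWeight c (q₄ ^^ q₆) +
        pairSum M)) := by
    intro q₁ q₂ q₃ q₄ q₅ q₆
    rw [← pairSum_chord c _ _ M, ← pairSum_chord b, ← pairSum_chord a]
    · congr 1
      simp only [← Multiset.singleton_add]
      abel
    · intro t ht
      apply ha
      simp only [Multiset.mem_cons] at ht
      rcases ht with rfl | rfl | rfl | rfl | ht
      · simp
      · simp
      · simp
      · simp
      · simp [hM t ht]
    · intro t ht
      apply hb
      simp only [Multiset.mem_cons] at ht
      rcases ht with rfl | rfl | ht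
      · simp
      · simp
      · simp [hM t ht]
    · exact fun t ht => hc _ (hM t ht)
  simp only [parityTag_ordered, chords, Visit.isClassical_flip]
  rcases h.kinds with ⟨ka, kb, kc⟩ | ⟨ka, kb⟩
  · have cl : ∀ {x : Visit Kind}, x.IsOver → x.isClassical = true := by
      rintro x (⟨hx, -⟩ | ⟨hx, -⟩) <;> simp [Visit.isClassical, hx]
    rw [cl ka, cl kb, cl kc]
    -- Swapping two adjacent classical visits changes both tags, so all six tags change and every
    -- chord keeps its tag difference.
    cases e₁ <;> cases e₂ <;> cases e₃ <;> simp
  -- In the virtual moves `a` and `b` have weight 0 and are not counted, so the tags of `c` do not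
  -- change.
  · have wa : ∀ d, chordWeight a d = 0 := fun d => by simp [chordWeight, ka, Kind.sign]
    have wb : ∀ d, chordWeight b d = 0 := fun d => by simp [chordWeight, kb, Kind.sign]
    have ca : a.isClassical = false := by simp [Visit.isClassical, ka]
    have cb : b.isClassical = false := by simp [Visit.isClassical, kb]
    simp only [wa, wb, ca, cb, Bool.and_false]

theorem oddWrithe_three {a b c : Visit Kind} {e₁ e₂ e₃ : Bool} (h : IsTriangle a b c e₁ e₂ e₃)
    (u v w : List (Visit Kind))
    (nodup : ((ordered e₁ a b ++ u ++ ordered e₂ a.flip c ++ v ++ ordered e₃ b.flip c.flip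
      ++ w).map Visit.pass).Nodup) :
    oddWrithe (ordered (!e₁) a b ++ u ++ ordered (!e₂) a.flip c ++ v
      ++ ordered (!e₃) b.flip c.flip ++ w) =
    oddWrithe (ordered e₁ a b ++ u ++ ordered e₂ a.flip c ++ v ++ ordered e₃ b.flip c.flip
      ++ w) := by
  have perm : (ordered e₁ a b ++ u ++ ordered e₂ a.flip c ++ v ++ ordered e₃ b.flip c.flip
      ++ w).Perm (a :: a.flip :: b :: b.flip :: c :: c.flip :: (u ++ v ++ w)) := by
    rw [← Multiset.coe_eq_coe]
    simp only [← Multiset.coe_add, ← Multiset.cons_coe, ← Multiset.singleton_add, coe_ordered]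
    abel
  unfold oddWrithe
  have sort : ∀ A U B V C W : Multiset (Visit Kind × Bool),
      A + U + B + V + C + W = A + B + C + (U + V + W) := fun A U B V C W => by abel
  simp only [parityTag_append, oddCount_append, oddCount_ordered, ← Multiset.coe_add, sort]
  refine pairSum_triangle h _ _ _ (u ++ v ++ w) _ ?_ ((perm.map _).nodup_iff.1 nodup)
  simp only [Multiset.mem_add, Multiset.mem_coe, List.mem_append]
  exact fun t ht => ht.imp (Or.imp mem_of_mem_parityTag mem_of_mem_parityTag) mem_of_mem_parityTag

theorem oddWrithe_three' {a b c : Visit Kind} {e₁ e₂ e₃ : Bool} (h : IsTriangle a b c e₁ e₂ e₃)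
    (u v w : List (Visit Kind))
    (nodup : ((ordered e₁ a b ++ u ++ ordered e₃ b.flip c.flip ++ v ++ ordered e₂ a.flip c
      ++ w).map Visit.pass).Nodup) :
    oddWrithe (ordered (!e₁) a b ++ u ++ ordered (!e₃) b.flip c.flip ++ v
      ++ ordered (!e₂) a.flip c ++ w) =
    oddWrithe (ordered e₁ a b ++ u ++ ordered e₃ b.flip c.flip ++ v ++ ordered e₂ a.flip c
      ++ w) := by
  have perm : (ordered e₁ a b ++ u ++ ordered e₃ b.flip c.flip ++ v ++ ordered e₂ a.flip c
      ++ w).Perm (a :: a.flip :: b :: b.flip :: c :: c.flip :: (u ++ v ++ w)) := by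
    rw [← Multiset.coe_eq_coe]
    simp only [← Multiset.coe_add, ← Multiset.cons_coe, ← Multiset.singleton_add, coe_ordered]
    abel
  unfold oddWrithe
  have sort : ∀ A U B V C W : Multiset (Visit Kind × Bool),
      A + U + C + V + B + W = A + B + C + (U + V + W) := fun A U B V C W => by abel
  simp only [parityTag_append, oddCount_append, oddCount_ordered, ← Multiset.coe_add, sort]
  refine pairSum_triangle h _ _ _ (u ++ v ++ w) _ ?_ ((perm.map _).nodup_iff.1 nodup)
  simp only [Multiset.mem_add, Multiset.mem_coe, List.mem_append]
  exact fun t ht => ht.imp (Or.imp mem_of_mem_parityTag mem_of_mem_parityTag) mem_of_mem_parityTag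

theorem oddWrithe_eq_of_move {D D' : VirtualDiagram} (h : Move D.word D'.word) :
    oddWrithe D.word = oddWrithe D'.word := by
  have nodup := D.nodup
  have nodup' := D'.nodup
  have even := oddCount_isClassical D.nodup D.flip_mem
  generalize D.word = s at h nodup even
  generalize D'.word = s' at h nodup'
  cases h with
  | rotate u v => exact oddWrithe_rotate u v even
  | rename σ => exact (oddWrithe_rename σ s).symm
  | one x => exact (oddWrithe_kink x s nodup').symm
  | two_parallel x y u v side kind => exact (oddWrithe_two_parallel x y u v kind nodup').symm
  | two_antiparallel x y u v side kind =>
    exact (oddWrithe_two_antiparallel x y u v kind nodup').symm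
  | three a b c e₁ e₂ e₃ h u v w => exact (oddWrithe_three h u v w nodup).symm
  | three' a b c e₁ e₂ e₃ h u v w => exact (oddWrithe_three' h u v w nodup).symm

theorem oddWrithe_eq_of_knot_eq {D D' : VirtualDiagram} (h : D.knot = D'.knot) :
    oddWrithe D.word = oddWrithe D'.word := by
  have h' : Relation.EqvGen (fun D D' : VirtualDiagram => Move D.word D'.word) D D' :=
    Quotient.exact h
  clear h
  induction h' with
  | rel _ _ h => exact oddWrithe_eq_of_move h
  | refl _ => rfl
  | symm _ _ _ ih => exact ih.symm
  | trans _ _ _ _ _ ih₁ ih₂ => exact ih₁.trans ih₂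

/-! ### The odd writhe detects non-classical knots. -/

theorem oddWrithe_eq_zero (D : VirtualDiagram) (hD : ∀ x ∈ D.word, x.isClassical = true) :
    oddWrithe D.word = 0 := by
  obtain ⟨o, chain, flip⟩ := isPlanar_coloring D.nodup (fun p hp => by
    obtain ⟨x, hx, rfl⟩ := List.mem_map.1 hp
    exact List.mem_map.2 ⟨_, D.flip_mem x hx, rfl⟩) D.planar
  rw [List.isChain_map] at chain
  obtain ⟨k, hk⟩ : ∃ k, ∀ x ∈ D.word.head?, o x.pass = (k ^^ false) := by
    cases D.word with
    | nil => exact ⟨false, by simp⟩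
    | cons x l => exact ⟨o x.pass, by simp⟩
  -- All visits are counted, so the tags alternate and agree with Gauss's colouring up to the
  -- constant `k`; hence the two tags of a crossing differ.
  have tag : ∀ t ∈ parityTag Visit.isClassical false D.word, o t.1.pass = (k ^^ t.2) :=
    fun t ht => parityTag_eq_of_isChain (o := fun x => o x.pass) _ hD chain hk ht
  unfold oddWrithe pairSum
  refine Multiset.sum_eq_zero fun n hn => ?_
  obtain ⟨t, ht, rfl⟩ := Multiset.mem_map.1 hn
  refine Multiset.sum_eq_zero fun n hn => ?_
  obtain ⟨t', ht', rfl⟩ := Multiset.mem_map.1 hn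
  refine if_neg ?_
  rintro ⟨hc, hs, h2⟩
  have hf : t'.1.pass = t.1.pass.flip := Prod.ext hc hs
  have h := flip t.1.pass (List.mem_map.2 ⟨_, mem_of_mem_parityTag (Multiset.mem_coe.1 ht), rfl⟩)
  rw [← hf, tag t ht, tag t' ht', h2] at h
  simp at h

theorem isNonClassical_of_oddWrithe_ne_zero {D : VirtualDiagram} (h : oddWrithe D.word ≠ 0) :
    D.knot.IsNonClassical := by
  refine Nat.one_le_iff_ne_zero.2 fun h0 => h ?_
  -- `sInf` of the empty set is also 0; `D` itself excludes that case.
  obtain ⟨D', hD', h0⟩ := (Nat.sInf_eq_zero.1 h0).resolve_right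
    (Set.Nonempty.ne_empty ⟨_, D, rfl, rfl⟩)
  rw [← oddWrithe_eq_of_knot_eq hD']
  refine oddWrithe_eq_zero D' fun x hx => ?_
  simp only [VirtualDiagram.virtualCount, List.countP_eq_zero, Bool.and_eq_true, decide_eq_true_eq,
    not_and, Bool.not_eq_true] at h0
  simp only [Visit.isClassical, decide_eq_true_eq]
  intro hk
  have h1 := h0 x hx hk
  have h2 : (!x.side) = false := h0 x.flip (D'.flip_mem x hx) hk
  simp [h1] at h2

/-! ### Resolutions of a pseudodiagram with two intersecting chords. -/

theorem exists_append_of_cons_sublist {α : Type*} {x : α} {l w : List α}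
    (h : (x :: l).Sublist w) : ∃ s r, w = s ++ x :: r ∧ l.Sublist r := by
  obtain ⟨r₁, r₂, rfl, hx, hl⟩ := List.cons_sublist_iff.1 h
  obtain ⟨s, t, rfl⟩ := List.append_of_mem hx
  exact ⟨s, t ++ r₂, by simp, hl.trans (List.sublist_append_right _ _)⟩

theorem oddCount_crossing_eq_false {T : Type} {b : ℕ} {l : List (Visit T)}
    (h : ∀ y ∈ l, y.crossing ≠ b) : oddCount (fun y => decide (y.crossing = b)) l = false := by
  induction l with
  | nil => rfl
  | cons y l ih =>
    rw [List.forall_mem_cons] at h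
    simp [oddCount, h.1, ih h.2]

namespace UberVirtualPseudodiagram

variable {P : UberVirtualPseudodiagram}

theorem IsPrecrossing.kind_eq {c : ℕ} (h : P.IsPrecrossing c) {y : Visit PseudoKind}
    (hy : y ∈ P.word) (hc : y.crossing = c) : y.kind = .pre := by
  obtain ⟨x, hx, rfl, hk⟩ := h
  have inj := List.inj_on_of_nodup_map P.nodup
  by_cases hs : y.side = x.side
  · rw [inj hy hx (Prod.ext hc hs), hk]
  · rw [inj hy (P.flip_mem x hx) (Prod.ext hc (Bool.eq_not_of_ne hs))]
    exact hk

/-- The type `k` for the precrossing `a`, the type `l` for `b`, and virtual for all others. -/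
def assign (a b : ℕ) (k l : Kind) (n : ℕ) : Kind :=
  if n = a then k else if n = b then l else .virt

theorem oddWrithe_resolve (r : ℕ → Kind) : oddWrithe (P.resolve r).word =
    ((parityTag (fun x => (x.resolve r).isClassical) false P.word :
      Multiset (Visit PseudoKind × Bool)).map fun t =>
      ((parityTag (fun x => (x.resolve r).isClassical) false P.word :
      Multiset (Visit PseudoKind × Bool)).map fun t' =>
        pairWeight (t.1.resolve r, t.2) (t'.1.resolve r, t'.2)).sum).sum := by
  unfold oddWrithe pairSum
  rw [show (P.resolve r).word = P.word.map (Visit.resolve r) from rfl, parityTag_map,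
    ← Multiset.map_coe]
  simp only [Multiset.map_map, Function.comp_def, Prod.map, id]

theorem isClassical_resolve_pos_neg (a b : ℕ) (l : Kind) (x : Visit PseudoKind) :
    (x.resolve (assign a b .neg l)).isClassical = (x.resolve (assign a b .pos l)).isClassical := by
  rcases x with ⟨n, s, k | _⟩
  · rfl
  · by_cases h : n = a <;> simp [Visit.isClassical, Visit.resolve, PseudoKind.resolve, assign, h]

/-- If the chord of a precrossing is odd, then the odd writhe depends on its sign. -/
theorem oddWrithe_resolve_ne {a b : ℕ} {l : Kind} {t t' : Visit PseudoKind × Bool}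
    (ht : t ∈ parityTag (fun x => (x.resolve (assign a b .pos l)).isClassical) false P.word)
    (ht' : t' ∈ parityTag (fun x => (x.resolve (assign a b .pos l)).isClassical) false P.word)
    (hk : t.1.kind = .pre) (hc : t.1.crossing = a) (hc' : t'.1.crossing = a)
    (hs : t'.1.side = !t.1.side) (h : t'.2 = t.2) :
    oddWrithe (P.resolve (assign a b .neg l)).word ≠
      oddWrithe (P.resolve (assign a b .pos l)).word := by
  rw [oddWrithe_resolve, oddWrithe_resolve]
  simp only [isClassical_resolve_pos_neg]
  -- The tags are the same for both signs of `a`, so the sums compare term by term; the terms of the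
  -- odd chord `a` drop strictly, from 1 to -1.
  have le : ∀ t t' : Visit PseudoKind × Bool,
      pairWeight (t.1.resolve (assign a b .neg l), t.2) (t'.1.resolve (assign a b .neg l), t'.2) ≤
      pairWeight (t.1.resolve (assign a b .pos l), t.2)
        (t'.1.resolve (assign a b .pos l), t'.2) := by
    rintro ⟨⟨n, s, k | _⟩, e⟩ ⟨⟨n', s', k'⟩, e'⟩
    · exact le_rfl
    · unfold pairWeight
      by_cases hn : n = a
      · simp only [Visit.resolve, PseudoKind.resolve, assign, hn, if_true, Kind.sign]
        split_ifs <;> decide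
      · simp [Visit.resolve, PseudoKind.resolve, assign, hn]
  refine ne_of_lt (Multiset.sum_lt_sum (fun t _ => Multiset.sum_map_le_sum_map _ _ fun t' _ => le t t')
    ⟨t, ht, Multiset.sum_lt_sum (fun t' _ => le t t') ⟨t', ht', ?_⟩⟩)
  simp [pairWeight, Visit.resolve, hc, hc', hs, h, hk, PseudoKind.resolve, assign, Kind.sign]

theorem exists_isNonClassical_of_sublist {a b : ℕ} (ha : P.IsPrecrossing a)
    (hb : P.IsPrecrossing b) (hab : [a, b, a, b].Sublist P.chordDiagram) :
    ∃ r : ℕ → Kind, (P.resolve r).knot.IsNonClassical := by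
  obtain ⟨l, hl, hm⟩ := List.sublist_map_iff.1 hab
  obtain ⟨x, y, x', y', rfl⟩ : ∃ x y x' y', l = [x, y, x', y'] :=
    List.length_eq_four.1 (by simpa using (congrArg List.length hm).symm)
  simp only [List.map_cons, List.map_nil, List.cons.injEq, and_true] at hm
  obtain ⟨hx, hy, hx', hy'⟩ := hm
  obtain ⟨u, r, hw, h⟩ := exists_append_of_cons_sublist (hl.trans List.filter_sublist)
  obtain ⟨v₁, r₁, rfl, h₁⟩ := exists_append_of_cons_sublist h
  obtain ⟨v₂, r₂, rfl, h₂⟩ := exists_append_of_cons_sublist h₁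
  obtain ⟨w₁, w₂, rfl, -⟩ := exists_append_of_cons_sublist h₂
  have nodup := P.nodup
  rw [hw] at nodup
  have perm : (u ++ x :: (v₁ ++ y :: (v₂ ++ x' :: (w₁ ++ y' :: w₂)))).Perm
      (y :: y' :: x :: x' :: (u ++ v₁ ++ v₂ ++ w₁ ++ w₂)) := by
    rw [← Multiset.coe_eq_coe]
    simp only [← Multiset.coe_add, ← Multiset.cons_coe, ← Multiset.singleton_add]
    abel
  have nodup' := (perm.map Visit.pass).nodup_iff.1 nodup
  have hne := crossing_ne_of_nodup (hy'.symm.trans hy) nodup'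
  rw [← hy] at hne
  have hba : a ≠ b := fun e => hne x (by simp) (by rw [← hx, e])
  have side := side_eq_not_of_nodup (hx'.symm.trans hx) (nodup'.sublist
    (((List.sublist_cons_self _ _).trans (List.sublist_cons_self _ _)).map _))
  -- Of the two visits of `b`, only `y` lies between the two visits of `a`.
  have hodd : oddCount (fun y => decide (y.crossing = b)) (v₁ ++ y :: v₂) = true := by
    rw [oddCount_append, oddCount, oddCount_crossing_eq_false fun z hz => hne z (by simp [hz]),
      oddCount_crossing_eq_false fun z hz => hne z (by simp [hz])]
    simp [hy]
  have hxk : x.kind = .pre := ha.kind_eq (by rw [hw]; simp) hx.symm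
  -- Changing `b` from virtual to positive changes the parity of the classical visits between those
  -- of `a`, so one of the two choices makes `a` odd.
  obtain ⟨l, hl⟩ : ∃ l, oddCount (fun z => (z.resolve (assign a b .pos l)).isClassical)
      (v₁ ++ y :: v₂) = true := by
    by_contra! hno
    have e : oddCount (fun z => (z.resolve (assign a b .pos .pos)).isClassical) (v₁ ++ y :: v₂) =
        oddCount (fun z => (z.resolve (assign a b .pos .virt)).isClassical ^^
          decide (z.crossing = b)) (v₁ ++ y :: v₂) := by
      refine oddCount_congr _ fun z hz => ?_
      by_cases hzb : z.crossing = b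
      · have hzk : z.kind = .pre := hb.kind_eq (by
          rw [hw]
          simp only [List.mem_append, List.mem_cons] at hz ⊢
          tauto) hzb
        simp [Visit.isClassical, Visit.resolve, PseudoKind.resolve, assign, hzb, hzk, hba.symm]
      · simp [Visit.resolve, assign, hzb]
    rw [oddCount_xor, hodd, Bool.eq_false_of_not_eq_true (hno .pos),
      Bool.eq_false_of_not_eq_true (hno .virt)] at e
    simp at e
  have hne : oddWrithe (P.resolve (assign a b .neg l)).word ≠
      oddWrithe (P.resolve (assign a b .pos l)).word := by
    let p : Visit PseudoKind → Bool := fun z => (z.resolve (assign a b .pos l)).isClassical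
    have hp : p x = true := by
      simp [p, Visit.isClassical, Visit.resolve, PseudoKind.resolve, assign, ← hx, hxk]
    refine oddWrithe_resolve_ne (t := (x, oddCount p u)) (t' := (x', oddCount p u)) ?_ ?_ hxk
      hx.symm hx'.symm side rfl
    · rw [hw, parityTag_append]
      simp [parityTag, p]
    -- From `x` to `x'` the tag changes once for `x` itself and by the odd count in between, so the
    -- two tags agree.
    · have e : u ++ x :: (v₁ ++ y :: (v₂ ++ x' :: (w₁ ++ y' :: w₂))) =
          u ++ ([x] ++ ((v₁ ++ y :: v₂) ++ x' :: (w₁ ++ y' :: w₂))) := by simp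
      have h1 : oddCount p [x] = true := by simp [oddCount, hp]
      change _ ∈ parityTag p false P.word
      rw [hw, e, parityTag_append, parityTag_append, parityTag_append, h1, hl]
      simp [parityTag]
  by_cases h0 : oddWrithe (P.resolve (assign a b .neg l)).word = 0
  · exact ⟨_, isNonClassical_of_oddWrithe_ne_zero fun h => hne (h0.trans h.symm)⟩
  · exact ⟨_, isNonClassical_of_oddWrithe_ne_zero h0⟩

end UberVirtualPseudodiagram

end VirtualKnots

theorem mainTheorem12 (P : VirtualKnots.UberVirtualPseudodiagram) (a b : ℕ)
    (ha : P.IsPrecrossing a) (hb : P.IsPrecrossing b) (hab : P.ChordsIntersect a b) :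
    ∃ r : ℕ → VirtualKnots.Kind, (P.resolve r).knot.IsNonClassical := by
  rcases hab with hab | hab
  · exact VirtualKnots.UberVirtualPseudodiagram.exists_isNonClassical_of_sublist ha hb hab
  · exact VirtualKnots.UberVirtualPseudodiagram.exists_isNonClassical_of_sublist hb ha hab
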